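/- Let $[n]=\{1,\dots,n\}$. A family $\mathcal G\subset 2^{[n]}$ is called $3$-wise $t$-intersecting if $|G_1\cap G_2\cap G_3|\ge t$ for all (not necessarily distinct) $G_1,G_2,G_3\in\mathcal G$. For $0<p<1$ its $p$-biased measure is $\mu_p(\mathcal G)=\sum_{G\in\mathcal G}p^{|G|}(1-p)^{n-|G|}$. Two families $\mathcal F,\mathcal H\subset 2^{[n]}$ are isomorphic, $\mathcal F\cong\mathcal H$, if $\mathcal H=\{\tau(F):F\in\mathcal F\}$ for some permutation $\tau$ of $[n]$. For an integer $i\ge 0$ with $t+3i\le n$ let $\mathcal F_i^t=\{F\subset[n]:|F\cap[t+3i]|\ge t+2i\}$, and for integers $t\ge 1$ let $p_0(t)=\frac{2}{\sqrt{4t+9}-1}$. **Theorem.** For every real $\delta>0$ there exists an integer $t_0\ge 0$ such that for all integers $t>t_0$ and all real $p$ with $0<p\le p_0(t)$ the following holds. For every $n$, if $\mathcal G\subset 2^{[n]}$ is a $3$-wise $t$-intersecting family with $\mu_p(\mathcal G)\ge\left(\frac12+\delta\right)p^t$, then there is a family $\mathcal F\subset 2^{[n]}$ with $\mathcal G\subset\mathcal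 F$ such that either $t\le n$ and $\mathcal F\cong\mathcal F_0^t$, or $t+3\le n$ and $\mathcal F\cong\mathcal F_1^t$. -/

import Mathlib

/-- A family `G` of subsets of `X` is `r`-wise `t`-intersecting if
`|G₁ ∩ ⋯ ∩ G_r| ≥ t` for all (not necessarily distinct) members `G₁, …, G_r` of `G`. -/
def WiseIntersecting {X : Type*} [Fintype X] [DecidableEq X]
    (r t : ℕ) (G : Finset (Finset X)) : Prop :=
  ∀ g : Fin r → Finset X, (∀ k, g k ∈ G) → t ≤ (Finset.univ.inf g).card

/-- The `p`-biased measure `μ_p(G : X) = ∑_{A ∈ G} p^|A| (1 - p)^(|X| - |A|)`.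
Here `A ⊆ X`, so the natural subtraction does not truncate. -/
noncomputable def biasedMeasure {X : Type*} [Fintype X]
    (p : ℝ) (G : Finset (Finset X)) : ℝ :=
  ∑ A ∈ G, p ^ A.card * (1 - p) ^ (Fintype.card X - A.card)

/-- Two families are isomorphic if a permutation of the ground set carries one to the other. -/
def FamilyIso {X : Type*} [DecidableEq X] (G H : Finset (Finset X)) : Prop :=
  ∃ τ : Equiv.Perm X, H = G.image (fun A => A.image τ)

/-- The family `{F ⊆ [n] : |F ∩ [t + r i]| ≥ t + (r - 1) i}` (used for `r ≥ 1` and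
`t + r i ≤ n`). The ground set `[n]` is `Fin n`, and `[m]` consists of the elements of `Fin n`
with value less than `m`. -/
def franklFamily (n r t i : ℕ) : Finset (Finset (Fin n)) :=
  Finset.univ.filter fun F =>
    t + (r - 1) * i ≤ (F.filter fun x : Fin n => (x : ℕ) < t + r * i).card

/-- The threshold `p₀(t) = 2 / (√(4t + 9) - 1)`. -/
noncomputable def pZero (t : ℕ) : ℝ := 2 / (Real.sqrt (4 * (t : ℝ) + 9) - 1)

/-!
Write `F_k` for a family `nearFull S k` with `|S| = t + r k`, a copy of the `k`-th Frankl family.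
The main point is that an `r`-wise `t`-intersecting family not contained in `F_k` meets it in
measure only `O(p) p ^ t`. Indeed, some member misses a set `Z` of `k + 1` points of `S`. Up to a
part of measure `O(p) p ^ t`, the members `A` in `F_k` miss exactly `k` points of `S`, none of them
in `Z`, and no `r - 1` of the sets `S ∆ A` are pairwise disjoint. With suitable new marginals on
`S`, the measure of `A` is at most `O(p ^ t)` times that of `S ∆ A`, and a random colouring of the
ground set with about `1 / p` colours shows that the family of these `S ∆ A` has measure `O(p)`.

Every member of a shifted `r`-wise `t`-intersecting family lies in `F_k` for some initial segment
`S = [t + r k]`, so if the family is contained in no single `F_k`, summing over `k` bounds its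
measure by `o(p ^ t)`. Undoing a shift keeps the family inside the union of two copies of `F_k`, to
which the same bound applies. Finally, `F_k` has measure at most `(1 / k! + o(1)) p ^ t`, which
rules out `k ≥ 2`.
-/

open Finset
open scoped FinsetFamily Topology

section Measure

variable {X : Type*} [Fintype X] {p : ℝ}

theorem biasedMeasure_mono (hp : 0 ≤ p) (hp1 : p ≤ 1) {G H : Finset (Finset X)} (h : G ⊆ H) :
    biasedMeasure p G ≤ biasedMeasure p H :=
  sum_le_sum_of_subset_of_nonneg h fun _ _ _ =>
    mul_nonneg (pow_nonneg hp _) (pow_nonneg (sub_nonneg.2 hp1) _)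

variable [DecidableEq X]

theorem biasedMeasure_union_le (hp : 0 ≤ p) (hp1 : p ≤ 1) (G H : Finset (Finset X)) :
    biasedMeasure p (G ∪ H) ≤ biasedMeasure p G + biasedMeasure p H := by
  unfold biasedMeasure
  rw [← sum_union_inter]
  exact le_add_of_nonneg_right (sum_nonneg fun _ _ =>
    mul_nonneg (pow_nonneg hp _) (pow_nonneg (sub_nonneg.2 hp1) _))

theorem biasedMeasure_biUnion_le {ι : Type*} (hp : 0 ≤ p) (hp1 : p ≤ 1) (I : Finset ι)
    (F : ι → Finset (Finset X)) :
    biasedMeasure p (I.biUnion F) ≤ ∑ i ∈ I, biasedMeasure p (F i) := by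
  classical
  induction I using Finset.induction_on with
  | empty => simp [biasedMeasure]
  | insert a I ha ih =>
    rw [biUnion_insert, sum_insert ha]
    exact (biasedMeasure_union_le hp hp1 _ _).trans (add_le_add_right ih _)

theorem biasedMeasure_Icc_univ (W : Finset X) : biasedMeasure p (Icc W univ) = p ^ #W := by
  have hdisj : ∀ B ∈ (univ \ W).powerset, Disjoint W B := fun B hB =>
    disjoint_of_subset_right (mem_powerset.1 hB) disjoint_sdiff
  have hinj : Set.InjOn (W ∪ ·) ((univ \ W).powerset : Set (Finset X)) := fun B hB C hC h => by
    rw [← union_sdiff_cancel_left (hdisj B hB), ← union_sdiff_cancel_left (hdisj C hC)]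
    exact congrArg (· \ W) h
  calc biasedMeasure p (Icc W univ)
      = ∑ B ∈ (univ \ W).powerset, p ^ #(W ∪ B) * (1 - p) ^ (Fintype.card X - #(W ∪ B)) := by
        rw [biasedMeasure, Icc_eq_image_powerset (subset_univ W), sum_image hinj]
    _ = ∑ B ∈ (univ \ W).powerset, p ^ #W * (p ^ #B * (1 - p) ^ (#(univ \ W) - #B)) := by
        refine sum_congr rfl fun B hB => ?_
        rw [card_union_of_disjoint (hdisj B hB), card_sdiff_of_subset (subset_univ W), card_univ,
          pow_add, mul_assoc, Nat.sub_sub]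
    _ = p ^ #W := by
        rw [← mul_sum, sum_pow_mul_eq_add_pow, add_sub_cancel, one_pow, mul_one]

/-- The probability of `U` under the product measure on subsets of `X` in which `x` is present
with probability `π x`; non-constant marginals are needed to reweight the `p`-biased measure. -/
def productWeight (π : X → ℝ) (U : Finset X) : ℝ := ∏ x, if x ∈ U then π x else 1 - π x

theorem productWeight_nonneg {π : X → ℝ} (h0 : ∀ x, 0 ≤ π x) (h1 : ∀ x, π x ≤ 1)
    (U : Finset X) : 0 ≤ productWeight π U :=
  prod_nonneg fun x _ => by split_ifs <;> linarith [h0 x, h1 x]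

theorem productWeight_ite (a b : ℝ) (S A : Finset X) :
    productWeight (fun x => if x ∈ S then a else b) A =
      a ^ #(S ∩ A) * (1 - a) ^ #(S \ A) * ∏ x ∈ Sᶜ, if x ∈ A then b else 1 - b := by
  rw [productWeight, ← prod_mul_prod_compl S]
  congr 1
  · rw [← filter_mem_eq_inter, sdiff_eq_filter, ← prod_const, ← prod_const, ← prod_ite]
    exact prod_congr rfl fun x hx => by simp only [hx, if_true]
  · exact prod_congr rfl fun x hx => by simp only [mem_compl.1 hx, if_false]

theorem productWeight_symmDiff (π : X → ℝ) (S A : Finset X) :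
    productWeight π (symmDiff S A) = productWeight (fun x => if x ∈ S then 1 - π x else π x) A := by
  refine prod_congr rfl fun x _ => ?_
  by_cases hS : x ∈ S <;> by_cases hA : x ∈ A <;> simp [mem_symmDiff, hS, hA]

theorem biasedMeasure_eq_sum_productWeight (p : ℝ) (G : Finset (Finset X)) :
    biasedMeasure p G = ∑ A ∈ G, productWeight (fun _ => p) A := by
  refine sum_congr rfl fun A _ => ?_
  have h := productWeight_ite p p univ A
  simp only [mem_univ, if_true, univ_inter, compl_univ, prod_empty, mul_one] at h
  rw [h, card_sdiff_of_subset (subset_univ A), card_univ]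

theorem sum_prod_filter_colorClass_eq {κ : Type*} [Fintype κ] [DecidableEq κ] {w : X → κ → ℝ}
    (hw : ∀ x, ∑ o, w x o = 1) (a : κ) (U : Finset X) :
    ∑ c : X → κ with ({x | c x = a} : Finset X) = U, ∏ x, w x (c x) =
      productWeight (fun x => w x a) U := by
  have hfactor : ∀ x, ∑ o ∈ (if x ∈ U then {a} else {a}ᶜ), w x o =
      if x ∈ U then w x a else 1 - w x a := by
    intro x
    split_ifs
    · rw [sum_singleton]
    · rw [← hw x, ← sum_add_sum_compl {a}, sum_singleton, add_sub_cancel_left]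
  rw [productWeight, ← prod_congr rfl fun x _ => hfactor x, prod_univ_sum]
  refine sum_congr ?_ fun _ _ => rfl
  ext c
  simp only [mem_filter, mem_univ, true_and, Fintype.mem_piFinset, Finset.ext_iff]
  refine forall_congr' fun x => ?_
  by_cases hx : x ∈ U <;> simp [hx]

/-- Colour each `x` with one of `m` colours, each with probability `π x`: every colour class has the
product distribution, and the classes are disjoint, so at most `s` of them lie in `H`. -/
theorem mul_sum_productWeight_le {π : X → ℝ} {m s : ℕ} (hπ : ∀ x, 0 ≤ π x)
    (hm : ∀ x, m * π x ≤ 1) {H : Finset (Finset X)}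
    (hH : ∀ U : Fin (s + 1) → Finset X, (∀ i, U i ∈ H) → ¬ Pairwise (Function.onFun Disjoint U)) :
    m * ∑ U ∈ H, productWeight π U ≤ s := by
  let w : X → Option (Fin m) → ℝ := fun x o => o.elim (1 - m * π x) fun _ => π x
  have hw_nonneg : ∀ x o, 0 ≤ w x o := by
    rintro x (_ | _)
    · exact sub_nonneg.2 (hm x)
    · exact hπ x
  have hw_sum : ∀ x, ∑ o, w x o = 1 := fun x => by simp [w, Fintype.sum_option]
  let colorClass (c : X → Option (Fin m)) (a : Fin m) : Finset X := {x | c x = some a}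
  have hclass_disjoint : ∀ c, Pairwise (Function.onFun Disjoint (colorClass c)) :=
    fun c a b hab => disjoint_left.2 fun x hxa hxb =>
      hab (Option.some.inj ((mem_filter.1 hxa).2.symm.trans (mem_filter.1 hxb).2))
  have hcount : ∀ c, #{a | colorClass c a ∈ H} ≤ s := fun c => by
    by_contra! h
    obtain ⟨f⟩ : Nonempty (Fin (s + 1) ↪ {a // colorClass c a ∈ H}) :=
      Function.Embedding.nonempty_of_card_le (by rwa [Fintype.card_fin, Fintype.card_subtype])
    exact hH (fun i => colorClass c (f i)) (fun i => (f i).2) fun i j hij =>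
      hclass_disjoint c fun h => hij (f.injective (Subtype.ext h))
  calc m * ∑ U ∈ H, productWeight π U
      = ∑ a : Fin m, ∑ U ∈ H, ∑ c : X → Option (Fin m) with colorClass c a = U,
          ∏ x, w x (c x) := by
        rw [sum_congr rfl fun a _ => sum_congr rfl fun U _ =>
          sum_prod_filter_colorClass_eq hw_sum (some a) U]
        simp [w]
    _ = ∑ c : X → Option (Fin m), ∑ a with colorClass c a ∈ H, ∏ x, w x (c x) := by
        simp only [sum_filter, sum_comm (s := H), sum_ite_eq]
        exact sum_comm
    _ ≤ ∑ c : X → Option (Fin m), s * ∏ x, w x (c x) := by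
        refine sum_le_sum fun c _ => ?_
        rw [sum_const, nsmul_eq_mul]
        exact mul_le_mul_of_nonneg_right (mod_cast hcount c) (prod_nonneg fun x _ => hw_nonneg x _)
    _ = s := by
        rw [← mul_sum, ← Fintype.piFinset_univ, ← prod_univ_sum, prod_congr rfl fun x _ => hw_sum x,
          prod_const_one, mul_one]

theorem sum_productWeight_le {π : X → ℝ} {s : ℕ} (hp : 0 < p) (hp1 : p ≤ 1)
    (hπ : ∀ x, 0 ≤ π x) (hπp : ∀ x, π x ≤ p) {H : Finset (Finset X)}
    (hH : ∀ U : Fin (s + 1) → Finset X, (∀ i, U i ∈ H) → ¬ Pairwise (Function.onFun Disjoint U)) :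
    ∑ U ∈ H, productWeight π U ≤ 2 * s * p := by
  set m := ⌊1 / p⌋₊
  have hmp : m * p ≤ 1 := (le_div_iff₀ hp).1 (Nat.floor_le (by positivity))
  have hpm : 1 ≤ 2 * p * m := by
    have h1 : (1 : ℝ) ≤ m := by
      exact_mod_cast Nat.le_floor (by rw [Nat.cast_one]; exact one_le_one_div hp hp1)
    have h2 : 1 < (m + 1) * p := (div_lt_iff₀ hp).1 (Nat.lt_floor_add_one _)
    nlinarith
  have hsum_nonneg : 0 ≤ ∑ U ∈ H, productWeight π U :=
    sum_nonneg fun U _ => productWeight_nonneg hπ (fun x => (hπp x).trans hp1) U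
  calc ∑ U ∈ H, productWeight π U ≤ 2 * p * m * ∑ U ∈ H, productWeight π U :=
        le_mul_of_one_le_left hsum_nonneg hpm
    _ = 2 * p * (m * ∑ U ∈ H, productWeight π U) := by ring
    _ ≤ 2 * p * s := by
        gcongr
        exact mul_sum_productWeight_le hπ
          (fun x => (mul_le_mul_of_nonneg_left (hπp x) m.cast_nonneg).trans hmp) hH
    _ = 2 * s * p := by ring

end Measure

section NearFull

variable {X : Type*} [Fintype X] [DecidableEq X] {p : ℝ} {S A : Finset X} {k : ℕ}

/-- The sets that contain all but at most `k` elements of `S`. When `|S| = t + r k`, this is the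
Frankl family `F_k^t` up to isomorphism. -/
def nearFull (S : Finset X) (k : ℕ) : Finset (Finset X) := {A | #(S \ A) ≤ k}

theorem mem_nearFull : A ∈ nearFull S k ↔ #(S \ A) ≤ k := by simp [nearFull]

theorem image_nearFull (τ : Equiv.Perm X) (S : Finset X) (k : ℕ) :
    (nearFull S k).image (image τ) = nearFull (S.image τ) k := by
  have hcard : ∀ A, #(S.image τ \ A.image τ) = #(S \ A) := fun A => by
    rw [← image_sdiff _ _ τ.injective, card_image_of_injective _ τ.injective]
  ext B
  obtain ⟨A, rfl⟩ : ∃ A, A.image τ = B := ⟨B.image τ.symm, by simp [image_image]⟩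
  rw [(image_injective τ.injective).mem_finset_image, mem_nearFull, mem_nearFull, hcard]

theorem biasedMeasure_nearFull_le (hp : 0 ≤ p) (hp1 : p ≤ 1) (hk : k ≤ #S) :
    biasedMeasure p (nearFull S k) ≤ (#S).choose k * p ^ (#S - k) := by
  have hcover : nearFull S k ⊆ (S.powersetCard k).biUnion fun Y => Icc (S \ Y) univ := by
    intro A hA
    obtain ⟨Y, hAY, hYS, hY⟩ := exists_subsuperset_card_eq sdiff_subset (mem_nearFull.1 hA) hk
    exact mem_biUnion.2 ⟨Y, mem_powersetCard.2 ⟨hYS, hY⟩,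
      mem_Icc.2 ⟨sdiff_le_comm.1 hAY, subset_univ A⟩⟩
  calc biasedMeasure p (nearFull S k)
      ≤ ∑ Y ∈ S.powersetCard k, biasedMeasure p (Icc (S \ Y) univ) :=
        (biasedMeasure_mono hp hp1 hcover).trans (biasedMeasure_biUnion_le hp hp1 _ _)
    _ = ∑ _ ∈ S.powersetCard k, p ^ (#S - k) := sum_congr rfl fun _ hY => by
        obtain ⟨hYS, hYk⟩ := mem_powersetCard.1 hY
        rw [biasedMeasure_Icc_univ, card_sdiff_of_subset hYS, hYk]
    _ = (#S).choose k * p ^ (#S - k) := by rw [sum_const, card_powersetCard, nsmul_eq_mul]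

theorem biasedMeasure_nearFull_le_pow_div_factorial {s t : ℕ} (hp : 0 ≤ p) (hp1 : p ≤ 1)
    (hS : #S = t + (s + 1) * k) :
    biasedMeasure p (nearFull S k) ≤ (#S * p ^ s) ^ k / k.factorial * p ^ t := by
  have hexp : #S = t + s * k + k := by rw [hS]; ring
  calc biasedMeasure p (nearFull S k) ≤ (#S).choose k * p ^ (#S - k) :=
        biasedMeasure_nearFull_le hp hp1 (by omega)
    _ ≤ (#S : ℝ) ^ k / k.factorial * p ^ (#S - k) := by
        gcongr
        exact Nat.choose_le_pow_div k _
    _ = (#S * p ^ s) ^ k / k.factorial * p ^ t := by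
        rw [show #S - k = t + s * k by omega, pow_add, pow_mul, mul_pow]
        ring

end NearFull

section Exclusion

variable {X : Type*} [Fintype X] [DecidableEq X] {p M : ℝ} {s t k : ℕ} {G : Finset (Finset X)}
  {S Z E : Finset X}

/-- If the sets `S ∆ A i` were disjoint, the sets `S \ A i` and `Z` would be `s + 1` disjoint
subsets of `S` missed by `E ∩ ⋂ i, A i`, which itself would lie in `S`: this leaves fewer than `t`
points. -/
theorem WiseIntersecting.not_pairwise_disjoint_symmDiff (hG : WiseIntersecting (s + 1) t G)
    (hs : 2 ≤ s) (hS : #S = t + (s + 1) * k) (hE : E ∈ G) (hZ : Z ⊆ S \ E) (hZk : k < #Z)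
    {A : Fin s → Finset X} (hA : ∀ i, A i ∈ G) (hAk : ∀ i, #(S \ A i) = k)
    (hAZ : ∀ i, Disjoint (S \ A i) Z) :
    ¬ Pairwise (Function.onFun Disjoint fun i => symmDiff S (A i)) := by
  intro hd
  set I := univ.inf (Fin.cons E A : Fin (s + 1) → Finset X)
  have hIE : I ⊆ E := inf_le (f := Fin.cons E A) (mem_univ 0)
  have hIA : ∀ i, I ⊆ A i := fun i => inf_le (f := Fin.cons E A) (mem_univ i.succ)
  have hIS : I ⊆ S := by
    intro x hx
    by_contra hxS
    have hxA : ∀ i, x ∈ symmDiff S (A i) := fun i => mem_symmDiff.2 (Or.inr ⟨hIA i hx, hxS⟩)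
    have h01 : (⟨0, by omega⟩ : Fin s) ≠ ⟨1, by omega⟩ := by simp
    exact disjoint_left.1 (hd h01) (hxA _) (hxA _)
  have hmissed : #(univ.biUnion (fun i => S \ A i) ∪ Z) = s * k + #Z := by
    rw [card_union_of_disjoint ((disjoint_biUnion_left _ _ _).2 fun i _ => hAZ i), card_biUnion]
    · simp [hAk]
    · exact fun i _ j _ hij => (hd hij).mono le_sup_left le_sup_left
  have hdisj : Disjoint I (univ.biUnion (fun i => S \ A i) ∪ Z) := by
    refine disjoint_union_right.2 ⟨(disjoint_biUnion_right _ _ _).2 fun i _ => ?_, ?_⟩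
    · exact disjoint_sdiff.mono_left (hIA i)
    · exact (disjoint_sdiff.mono_left hIE).mono_right hZ
  have hle : #I + (s * k + #Z) ≤ t + (s + 1) * k := by
    rw [← hmissed, ← card_union_of_disjoint hdisj, ← hS]
    exact card_le_card (union_subset hIS (union_subset
      (biUnion_subset.2 fun i _ => sdiff_subset) (hZ.trans sdiff_subset)))
  have htI : t ≤ #I := hG _ (Fin.forall_fin_succ.2 ⟨hE, hA⟩)
  rw [add_one_mul] at hle
  omega

theorem productWeight_le_symmDiff (hp : 0 ≤ p) (hp1 : p ≤ 1) (hM : 1 ≤ M)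
    (hS : #S = t + (s + 1) * k) (hSM : #S * p ^ s ≤ M) {A : Finset X} (hA : #(S \ A) = k) :
    productWeight (fun _ => p) A ≤ 2 * (2 * M) ^ k * p ^ t *
      productWeight (fun x => if x ∈ S then p ^ s / (2 * M) else p) (symmDiff S A) := by
  set θ := p ^ s / (2 * M) with hθ
  have hM0 : 0 < 2 * M := by linarith
  have : 0 ≤ θ := by positivity
  have hθ1 : θ ≤ 1 := (div_le_one hM0).2 ((pow_le_one₀ hp hp1).trans (by linarith))
  have hSA : #(S ∩ A) = t + s * k := by
    have := card_sdiff_add_card_inter S A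
    rw [hA, hS, add_one_mul] at this
    omega
  have hbernoulli : 1 / 2 ≤ (1 - θ) ^ #(S ∩ A) := by
    have hle : (#(S ∩ A) : ℝ) * θ ≤ 1 / 2 := by
      calc (#(S ∩ A) : ℝ) * θ ≤ #S * θ := by
            gcongr
            exact inter_subset_left
        _ = #S * p ^ s / (2 * M) := mul_div_assoc' _ _ _
        _ ≤ M / (2 * M) := by gcongr
        _ = 1 / 2 := by field_simp
    have := one_add_mul_le_pow (a := -θ) (by linarith) #(S ∩ A)
    rw [← sub_eq_add_neg] at this
    linarith
  have hflip : (fun x => if x ∈ S then 1 - (if x ∈ S then θ else p) else if x ∈ S then θ else p) =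
      fun x => if x ∈ S then 1 - θ else p := by
    ext x
    split_ifs <;> rfl
  have hconst := productWeight_ite p p S A
  simp only [ite_self] at hconst
  rw [productWeight_symmDiff, hflip, productWeight_ite, sub_sub_cancel, hconst, ← mul_assoc, hA]
  refine mul_le_mul_of_nonneg_right ?_ (prod_nonneg fun x _ => by split_ifs <;> linarith)
  calc p ^ #(S ∩ A) * (1 - p) ^ k ≤ p ^ #(S ∩ A) * 1 := by
        gcongr
        exact pow_le_one₀ (by linarith) (by linarith)
    _ = 2 * (2 * M) ^ k * p ^ t * (1 / 2 * θ ^ k) := by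
        rw [hSA, hθ, div_pow, pow_add, pow_mul]
        field_simp
    _ ≤ 2 * (2 * M) ^ k * p ^ t * ((1 - θ) ^ #(S ∩ A) * θ ^ k) := by gcongr

theorem WiseIntersecting.biasedMeasure_filter_disjoint_le (hG : WiseIntersecting (s + 1) t G)
    (hs : 2 ≤ s) (hp : 0 < p) (hp1 : p ≤ 1) (hM : 1 ≤ M) (hS : #S = t + (s + 1) * k)
    (hSM : #S * p ^ s ≤ M) (hE : E ∈ G) (hZ : Z ⊆ S \ E) (hZk : k < #Z) :
    biasedMeasure p {A ∈ G | #(S \ A) = k ∧ Disjoint (S \ A) Z} ≤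
      4 * s * (2 * M) ^ k * p * p ^ t := by
  set H := {A ∈ G | #(S \ A) = k ∧ Disjoint (S \ A) Z} with hH
  set π : X → ℝ := fun x => if x ∈ S then p ^ s / (2 * M) else p
  have hπ : ∀ x, 0 ≤ π x := fun x => by
    simp only [π]
    split_ifs <;> positivity
  have hπp : ∀ x, π x ≤ p := fun x => by
    simp only [π]
    split_ifs
    · exact (div_le_self (by positivity) (by linarith)).trans
        (pow_le_of_le_one hp.le hp1 (by omega))
    · exact le_rfl
  have hmatching : ∀ U : Fin (s - 1 + 1) → Finset X, (∀ i, U i ∈ H.image (symmDiff S)) →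
      ¬ Pairwise (Function.onFun Disjoint U) := by
    rw [Nat.sub_add_cancel (by omega)]
    intro U hU
    choose A hA hAU using fun i => mem_image.1 (hU i)
    obtain rfl : (fun i => symmDiff S (A i)) = U := funext hAU
    simp only [hH, mem_filter] at hA
    exact hG.not_pairwise_disjoint_symmDiff hs hS hE hZ hZk (fun i => (hA i).1)
      (fun i => (hA i).2.1) fun i => (hA i).2.2
  calc biasedMeasure p H
      ≤ ∑ A ∈ H, 2 * (2 * M) ^ k * p ^ t * productWeight π (symmDiff S A) := by
        rw [biasedMeasure_eq_sum_productWeight]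
        exact sum_le_sum fun A hA =>
          productWeight_le_symmDiff hp.le hp1 hM hS hSM (mem_filter.1 hA).2.1
    _ = 2 * (2 * M) ^ k * p ^ t * ∑ U ∈ H.image (symmDiff S), productWeight π U := by
        rw [sum_image (symmDiff_right_injective S).injOn, mul_sum]
    _ ≤ 2 * (2 * M) ^ k * p ^ t * (2 * (s - 1 : ℕ) * p) := by
        gcongr
        exact sum_productWeight_le hp hp1 hπ hπp hmatching
    _ ≤ 2 * (2 * M) ^ k * p ^ t * (2 * s * p) := by
        gcongr
        exact Nat.sub_le s 1
    _ = 4 * s * (2 * M) ^ k * p * p ^ t := by ring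

theorem biasedMeasure_nearFull_erase_le (hs : 1 ≤ s) (hp : 0 ≤ p) (hp1 : p ≤ 1) (hM : 1 ≤ M)
    (hS : #S = t + (s + 1) * (k + 1)) (hSM : #S * p ^ s ≤ M) {z : X} (hz : z ∈ S) :
    biasedMeasure p (nearFull (S.erase z) k) ≤ M ^ (k + 1) * p * p ^ t := by
  have hexp : #S = t + s * k + s + k + 1 := by rw [hS]; ring
  have hcard : #(S.erase z) = t + s * k + s + k := by rw [card_erase_of_mem hz, hexp]; rfl
  calc biasedMeasure p (nearFull (S.erase z) k)
      ≤ (#(S.erase z)).choose k * p ^ (#(S.erase z) - k) :=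
        biasedMeasure_nearFull_le hp hp1 (by omega)
    _ ≤ (#S : ℝ) ^ k * p ^ (#(S.erase z) - k) := by
        gcongr
        exact_mod_cast (Nat.choose_le_pow _ _).trans
          (Nat.pow_le_pow_left (card_le_card (erase_subset z S)) k)
    _ = (#S * p ^ s) ^ k * p ^ s * p ^ t := by
        rw [hcard, Nat.add_sub_cancel, pow_add, pow_add, pow_mul, mul_pow]
        ring
    _ ≤ M ^ k * p * p ^ t := by
        gcongr
        exact pow_le_of_le_one hp hp1 (by omega)
    _ ≤ M ^ (k + 1) * p * p ^ t := by
        gcongr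
        exact Nat.le_succ k

theorem biasedMeasure_filter_nearFull_le (hs : 1 ≤ s) (hp : 0 ≤ p) (hp1 : p ≤ 1) (hM : 1 ≤ M)
    (hS : #S = t + (s + 1) * k) (hSM : #S * p ^ s ≤ M) (hZ : Z ⊆ S) (hZ0 : Z.Nonempty) :
    biasedMeasure p {A ∈ nearFull S k | ¬ (#(S \ A) = k ∧ Disjoint (S \ A) Z)} ≤
      #Z * M ^ k * p * p ^ t := by
  cases k with
  | zero =>
    rw [filter_false_of_mem, biasedMeasure, sum_empty]
    · positivity
    · intro A hA
      have hSA : #(S \ A) = 0 := Nat.le_zero.1 (mem_nearFull.1 hA)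
      rw [card_eq_zero.1 hSA]
      simp
  | succ k =>
    have hcover : {A ∈ nearFull S (k + 1) | ¬ (#(S \ A) = k + 1 ∧ Disjoint (S \ A) Z)} ⊆
        Z.biUnion fun z => nearFull (S.erase z) k := by
      intro A hA
      obtain ⟨hAk, hA'⟩ := mem_filter.1 hA
      rw [mem_nearFull] at hAk
      simp only [mem_biUnion, mem_nearFull, erase_sdiff_comm]
      rcases hAk.lt_or_eq with hlt | heq
      · obtain ⟨z, hz⟩ := hZ0
        exact ⟨z, hz, card_erase_le.trans (Nat.lt_succ_iff.1 hlt)⟩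
      · obtain ⟨z, hzA, hz⟩ := not_disjoint_iff.1 fun h => hA' ⟨heq, h⟩
        exact ⟨z, hz, by rw [card_erase_of_mem hzA, heq, Nat.add_sub_cancel]⟩
    calc biasedMeasure p {A ∈ nearFull S (k + 1) | ¬ (#(S \ A) = k + 1 ∧ Disjoint (S \ A) Z)}
        ≤ ∑ z ∈ Z, biasedMeasure p (nearFull (S.erase z) k) :=
          (biasedMeasure_mono hp hp1 hcover).trans (biasedMeasure_biUnion_le hp hp1 _ _)
      _ ≤ ∑ _ ∈ Z, M ^ (k + 1) * p * p ^ t :=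
          sum_le_sum fun _ hz => biasedMeasure_nearFull_erase_le hs hp hp1 hM hS hSM (hZ hz)
      _ = #Z * M ^ (k + 1) * p * p ^ t := by
          rw [sum_const, nsmul_eq_mul]
          ring

theorem WiseIntersecting.biasedMeasure_inter_nearFull_le (hG : WiseIntersecting (s + 1) t G)
    (hs : 2 ≤ s) (hp : 0 < p) (hp1 : p ≤ 1) (hM : 1 ≤ M) (hS : #S = t + (s + 1) * k)
    (hSM : #S * p ^ s ≤ M) (hGS : ¬ G ⊆ nearFull S k) :
    biasedMeasure p (G ∩ nearFull S k) ≤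
      (4 * s * (2 * M) ^ k + (k + 1) * M ^ k) * p * p ^ t := by
  obtain ⟨E, hE, hES⟩ := not_subset.1 hGS
  rw [mem_nearFull, not_le] at hES
  obtain ⟨Z, hZ, hZk⟩ := exists_subset_card_eq (Nat.succ_le_of_lt hES)
  have hcover : G ∩ nearFull S k ⊆ {A ∈ G | #(S \ A) = k ∧ Disjoint (S \ A) Z} ∪
      {A ∈ nearFull S k | ¬ (#(S \ A) = k ∧ Disjoint (S \ A) Z)} := by
    intro A hA
    simp only [mem_union, mem_filter, mem_inter] at hA ⊢
    tauto
  calc biasedMeasure p (G ∩ nearFull S k)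
      ≤ biasedMeasure p {A ∈ G | #(S \ A) = k ∧ Disjoint (S \ A) Z} +
          biasedMeasure p {A ∈ nearFull S k | ¬ (#(S \ A) = k ∧ Disjoint (S \ A) Z)} :=
        (biasedMeasure_mono hp.le hp1 hcover).trans (biasedMeasure_union_le hp.le hp1 _ _)
    _ ≤ 4 * s * (2 * M) ^ k * p * p ^ t + #Z * M ^ k * p * p ^ t :=
        add_le_add
          (hG.biasedMeasure_filter_disjoint_le hs hp hp1 hM hS hSM hE hZ (by omega))
          (biasedMeasure_filter_nearFull_le (by omega) hp.le hp1 hM hS hSM (hZ.trans sdiff_subset)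
            (card_pos.1 (by omega)))
    _ = (4 * s * (2 * M) ^ k + (k + 1) * M ^ k) * p * p ^ t := by
        rw [hZk]
        push_cast
        ring

end Exclusion

section Compression

theorem sum_compression {α β : Type*} [GeneralizedBooleanAlgebra α]
    [DecidableRel (@Disjoint α _ _)] [DecidableLE α] [DecidableEq α] [AddCommMonoid β]
    (u v : α) (G : Finset α) (f : α → β) :
    ∑ b ∈ 𝓒 u v G, f b =
      ∑ a ∈ G, if UV.compress u v a ∈ G then f a else f (UV.compress u v a) := by
  rw [UV.compression, sum_union UV.compress_disjoint, filter_image, sum_image UV.compress_injOn,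
    sum_ite]

theorem exists_compress_notMem {α : Type*} [GeneralizedBooleanAlgebra α]
    [DecidableRel (@Disjoint α _ _)] [DecidableLE α] [DecidableEq α] {u v : α} {G : Finset α}
    (h : ¬ UV.IsCompressed u v G) : ∃ a ∈ G, UV.compress u v a ∉ G := by
  contrapose! h
  exact (eq_of_subset_of_card_le (fun a ha => UV.mem_compression.2 (Or.inl ⟨ha, h a ha⟩))
    (UV.card_compression u v G).le).symm

variable {X : Type*} [DecidableEq X] {i j : X} {G : Finset (Finset X)}

theorem compress_singleton {A : Finset X} (hi : i ∉ A) (hj : j ∈ A) :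
    UV.compress {i} {j} A = (A ∪ {i}) \ {j} :=
  UV.compress_of_disjoint_of_le (disjoint_singleton_left.2 hi) (singleton_subset_iff.2 hj)

theorem compress_singleton_eq_or (i j : X) (A : Finset X) :
    UV.compress {i} {j} A = A ∨ i ∉ A ∧ j ∈ A ∧ UV.compress {i} {j} A = (A ∪ {i}) \ {j} := by
  by_cases h : i ∉ A ∧ j ∈ A
  · exact Or.inr ⟨h.1, h.2, compress_singleton h.1 h.2⟩
  · rw [← disjoint_singleton_left, ← singleton_subset_iff] at h
    exact Or.inl (if_neg h)

theorem exists_of_mem_compression_singleton {B : Finset X} (hB : B ∈ 𝓒 {i} {j} G) :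
    ∃ A ∈ G, B = A ∧ UV.compress {i} {j} A ∈ G ∨ i ∉ A ∧ j ∈ A ∧ B = (A ∪ {i}) \ {j} := by
  rcases UV.mem_compression.1 hB with ⟨hBG, hc⟩ | ⟨hBG, A, hA, rfl⟩
  · exact ⟨B, hBG, Or.inl ⟨rfl, hc⟩⟩
  · rcases compress_singleton_eq_or i j A with h | h
    · exact absurd (h.symm ▸ hA) hBG
    · exact ⟨A, hA, Or.inr h⟩

variable [Fintype X]

theorem biasedMeasure_compression (p : ℝ) (i j : X) (G : Finset (Finset X)) :
    biasedMeasure p (𝓒 {i} {j} G) = biasedMeasure p G := by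
  unfold biasedMeasure
  simp only [sum_compression, UV.card_compress (u := {i}) (v := {j}) rfl, ite_self]

/-- Replace `a k₁` by its compression: this removes `j` from the intersection, and `i` cannot enter
because of `a k₀`. -/
theorem WiseIntersecting.le_card_inf_erase {r t : ℕ} (hG : WiseIntersecting r t G)
    {a : Fin r → Finset X} (ha : ∀ k, a k ∈ G) {k₀ k₁ : Fin r} (hk : k₀ ≠ k₁) (hi₀ : i ∉ a k₀)
    (hi₁ : i ∉ a k₁) (hj₁ : j ∈ a k₁) (hc : UV.compress {i} {j} (a k₁) ∈ G) :
    t ≤ #((univ.inf a).erase j) := by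
  let b := Function.update a k₁ (UV.compress {i} {j} (a k₁))
  have hb₁ : b k₁ = (a k₁ ∪ {i}) \ {j} :=
    (Function.update_self ..).trans (compress_singleton hi₁ hj₁)
  have hb : ∀ k ≠ k₁, b k = a k := fun k hk => Function.update_of_ne hk ..
  have hbG : ∀ k, b k ∈ G := by
    intro k
    rcases eq_or_ne k k₁ with rfl | hk
    · rwa [show b k = _ from Function.update_self ..]
    · exact hb k hk ▸ ha k
  refine (hG b hbG).trans (card_le_card fun x hx => ?_)
  have hxb : ∀ k, x ∈ b k := fun k => inf_le (f := b) (mem_univ k) hx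
  have hxi : x ≠ i := fun h => hi₀ (hb k₀ hk ▸ h ▸ hxb k₀)
  have hx₁ := hxb k₁
  simp only [hb₁, Finset.mem_sdiff, mem_union, mem_singleton, hxi, or_false] at hx₁
  refine mem_erase.2 ⟨hx₁.2, Finset.mem_inf.2 fun k _ => ?_⟩
  rcases eq_or_ne k k₁ with rfl | hk
  · exact hx₁.1
  · exact hb k hk ▸ hxb k

theorem WiseIntersecting.compression {r t : ℕ} (hG : WiseIntersecting r t G) (hij : i ≠ j) :
    WiseIntersecting r t (𝓒 {i} {j} G) := by
  intro g hg
  choose a ha hcase using fun k => exists_of_mem_compression_singleton (hg k)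
  rcases eq_or_ne g a with rfl | hne
  · exact hG g ha
  obtain ⟨k₀, hk₀⟩ := Function.ne_iff.1 hne
  have hik₀ : i ∉ a k₀ := ((hcase k₀).resolve_left fun h => hk₀ h.1).1
  have hia : i ∉ univ.inf a := fun h => hik₀ (inf_le (f := a) (mem_univ k₀) h)
  have hsub : (univ.inf a).erase j ⊆ univ.inf g := by
    intro x hx
    obtain ⟨hxj, hxa⟩ := mem_erase.1 hx
    refine Finset.mem_inf.2 fun k hk => ?_
    have hxk := Finset.mem_inf.1 hxa k hk
    rcases hcase k with ⟨h, -⟩ | ⟨-, -, h⟩ <;> simp [h, hxj, hxk]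
  by_cases hja : j ∈ univ.inf a
  swap
  · exact (hG a ha).trans (card_le_card (erase_eq_of_notMem hja ▸ hsub))
  by_cases hig : ∀ k, i ∈ g k
  · have hcard := card_le_card (insert_subset (Finset.mem_inf.2 fun k _ => hig k) hsub)
    rw [card_insert_of_notMem fun h => hia (mem_of_mem_erase h), card_erase_add_one hja] at hcard
    exact (hG a ha).trans hcard
  · obtain ⟨k₁, hk₁⟩ := not_forall.1 hig
    obtain ⟨hga, hc⟩ := (hcase k₁).resolve_right fun h => hk₁ (by simp [h.2.2, hij])
    have hk : k₀ ≠ k₁ := fun h => hk₀ (h ▸ hga)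
    exact (hG.le_card_inf_erase ha hk hik₀ (hga ▸ hk₁) (inf_le (f := a) (mem_univ k₁) hja) hc).trans
      (card_le_card hsub)

theorem subset_union_nearFull_of_compression_subset {S : Finset X} {k : ℕ}
    (h : 𝓒 {i} {j} G ⊆ nearFull S k) :
    G ⊆ nearFull S k ∪ nearFull (S.image (Equiv.swap i j)) k := by
  intro A hA
  have hcA : UV.compress {i} {j} A ∈ nearFull S k := h (UV.compress_mem_compression hA)
  rcases compress_singleton_eq_or i j A with heq | ⟨hi, hj, heq⟩
  · exact mem_union_left _ (heq ▸ hcA)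
  · have hswap : ((A ∪ {i}) \ {j}).image (Equiv.swap i j) = A := by
      ext x
      rw [← Equiv.coe_toEmbedding, ← map_eq_image, mem_map_equiv, Equiv.symm_swap,
        Equiv.swap_apply_def]
      grind
    rw [mem_union, ← image_nearFull, ← hswap]
    exact Or.inr (mem_image_of_mem _ (heq ▸ hcA))

end Compression

section Shifted

variable {X : Type*} [LinearOrder X] {G : Finset (Finset X)}

/-- Shifted families: those stable under replacing an element `j` of a member by a smaller `i`,
which is what the compression `𝓒 {i} {j}` does. -/
def IsShifted (G : Finset (Finset X)) : Prop := ∀ ⦃i j⦄, i < j → UV.IsCompressed {i} {j} G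

theorem IsShifted.union_sdiff_mem (hG : IsShifted G) {A : Finset X} (hA : A ∈ G) {i j : X}
    (hij : i < j) (hi : i ∉ A) (hj : j ∈ A) : (A ∪ {i}) \ {j} ∈ G := by
  rw [← (hG hij).eq, ← compress_singleton hi hj]
  exact UV.compress_mem_compression hA

variable [LocallyFiniteOrderBot X]

theorem sum_card_Iio_compression_lt {i j : X} (hij : i < j) (hG : ¬ UV.IsCompressed {i} {j} G) :
    ∑ A ∈ 𝓒 {i} {j} G, ∑ x ∈ A, #(Iio x) < ∑ A ∈ G, ∑ x ∈ A, #(Iio x) := by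
  have hmove : ∀ A : Finset X, UV.compress {i} {j} A ≠ A →
      ∑ x ∈ UV.compress {i} {j} A, #(Iio x) < ∑ x ∈ A, #(Iio x) := by
    intro A hne
    obtain ⟨hi, hj, heq⟩ := (compress_singleton_eq_or i j A).resolve_left hne
    have hlt : #(Iio i) < #(Iio j) := card_lt_card (Iio_ssubset_Iio hij)
    have hsum := sum_sdiff (f := fun x => #(Iio x))
      (singleton_subset_iff.2 (mem_union_left {i} hj))
    rw [sum_union (disjoint_singleton_right.2 hi), sum_singleton, sum_singleton] at hsum
    rw [heq]
    omega
  rw [sum_compression]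
  obtain ⟨A, hA, hAG⟩ := exists_compress_notMem hG
  refine sum_lt_sum (fun B hB => ?_) ⟨A, hA, ?_⟩
  · split_ifs with h
    · exact le_rfl
    · exact (hmove B fun h' => h (h'.symm ▸ hB)).le
  · rw [if_neg hAG]
    exact hmove A fun h => hAG (h.symm ▸ hA)

theorem induction_on_compression {P : Finset (Finset X) → Prop} (G : Finset (Finset X))
    (shifted : ∀ G, IsShifted G → P G)
    (compression : ∀ G, ∀ i j, i ≠ j → P (𝓒 {i} {j} G) → P G) : P G := by
  induction h : ∑ A ∈ G, ∑ x ∈ A, #(Iio x) using Nat.strong_induction_on generalizing G with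
  | _ N ih =>
    by_cases hG : IsShifted G
    · exact shifted G hG
    · simp only [IsShifted, not_forall] at hG
      obtain ⟨i, j, hij, hcomp⟩ := hG
      exact compression G i j hij.ne
        (ih _ (h ▸ sum_card_Iio_compression_lt hij hcomp) _ rfl)

/-- Replace the least element of `A ∩ M` by some smaller `b ∉ A ∪ M`, and repeat. -/
theorem IsShifted.exists_disjoint (hG : IsShifted G) {A M : Finset X} (hA : A ∈ G)
    (hAM : ∀ a, #(Iic a ∩ M) ≤ #(Iic a \ A)) : ∃ C ∈ G, Disjoint C M := by
  induction h : #(A ∩ M) generalizing A with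
  | zero => exact ⟨A, hA, disjoint_iff_inter_eq_empty.2 (card_eq_zero.1 h)⟩
  | succ N ih =>
    obtain ⟨a, ha, hmin⟩ := exists_min_image (A ∩ M) id (card_pos.1 (h ▸ N.succ_pos))
    obtain ⟨haA, haM⟩ := mem_inter.1 ha
    obtain ⟨b, hba, hbA, hbM⟩ : ∃ b < a, b ∉ A ∧ b ∉ M := by
      by_contra! hcon
      have hss : Iic a \ A ⊂ Iic a ∩ M := by
        refine (ssubset_iff_of_subset fun x hx => ?_).2
          ⟨a, mem_inter.2 ⟨mem_Iic.2 le_rfl, haM⟩, fun hx => (mem_sdiff.1 hx).2 haA⟩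
        obtain ⟨hxa, hxA⟩ := mem_sdiff.1 hx
        have hne : x ≠ a := fun h => hxA (h ▸ haA)
        exact mem_inter.2 ⟨hxa, hcon x ((mem_Iic.1 hxa).lt_of_ne hne) hxA⟩
      exact (hAM a).not_gt (card_lt_card hss)
    refine ih (hG.union_sdiff_mem hA hba hbA haA) (fun m => ?_) ?_
    · by_cases ham : a ≤ m
      · refine (hAM m).trans ?_
        have hb : b ∈ Iic m \ A := mem_sdiff.2 ⟨mem_Iic.2 (hba.le.trans ham), hbA⟩
        have hsub : insert a ((Iic m \ A).erase b) ⊆ Iic m \ ((A ∪ {b}) \ {a}) := by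
          intro x hx
          simp only [mem_insert, mem_erase, mem_sdiff, mem_union, mem_singleton, mem_Iic] at hx ⊢
          grind
        have hcard := card_le_card hsub
        rwa [card_insert_of_notMem (by simp [haA]), card_erase_add_one hb] at hcard
      · refine card_le_card fun x hx => ?_
        obtain ⟨hxm, hxM⟩ := mem_inter.1 hx
        have hxa : x < a := (mem_Iic.1 hxm).trans_lt (not_le.1 ham)
        have hxA : x ∉ A := fun hxA => (hmin x (mem_inter.2 ⟨hxA, hxM⟩)).not_gt hxa
        have hxb : x ≠ b := fun h => hbM (h ▸ hxM)
        simp [hxA, hxb, mem_Iic.1 hxm]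
    · have : ((A ∪ {b}) \ {a}) ∩ M = (A ∩ M).erase a := by grind
      rw [this, card_erase_of_mem ha, h, Nat.add_sub_cancel]

end Shifted

section InitialSegment

variable {n r t : ℕ}

/-- The initial segment `[m]` of `[n]`; it is all of `[n]` when `n < m`. -/
def initialSegment (n m : ℕ) : Finset (Fin n) := {x | (x : ℕ) < m}

theorem mem_initialSegment {m : ℕ} {x : Fin n} : x ∈ initialSegment n m ↔ (x : ℕ) < m := by
  simp [initialSegment]

theorem card_initialSegment (n m : ℕ) : #(initialSegment n m) = min n m :=
  Fin.card_filter_val_lt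

/-- The `x ≥ t` in `[n]` with `x ≡ t + c` modulo `r`, where `c < r`; the element `x` of `Fin n`
stands for `x + 1` in `[n]`. -/
def tailClass (n r t c : ℕ) : Finset (Fin n) := {x | t ≤ x + 1 ∧ (x + 1 - t) % r = c}

theorem mem_tailClass {c : ℕ} {x : Fin n} :
    x ∈ tailClass n r t c ↔ t ≤ x + 1 ∧ (x + 1 - t) % r = c := by simp [tailClass]

theorem card_Iic_inter_tailClass_le (r t c : ℕ) (a : Fin n) :
    #(Iic a ∩ tailClass n r t c) ≤ (a + 1 - t) / r + 1 := by
  rw [← card_range ((a + 1 - t) / r + 1)]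
  refine card_le_card_of_injOn (fun x => (x + 1 - t) / r) (fun x hx => ?_) fun x hx y hy hxy => ?_
  · have := Fin.le_def.1 (mem_Iic.1 (mem_inter.1 hx).1)
    exact mem_range.2 (Nat.lt_succ_iff.2 (Nat.div_le_div_right (by omega)))
  · obtain ⟨htx, hcx⟩ := mem_tailClass.1 (mem_inter.1 hx).2
    obtain ⟨hty, hcy⟩ := mem_tailClass.1 (mem_inter.1 hy).2
    have hdiv : ((x : ℕ) + 1 - t) / r = (y + 1 - t) / r := hxy
    have hx' := Nat.div_add_mod ((x : ℕ) + 1 - t) r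
    have hy' := Nat.div_add_mod ((y : ℕ) + 1 - t) r
    rw [hdiv, hcx] at hx'
    rw [hcy] at hy'
    exact Fin.ext (by omega)

/-- Otherwise `A` misses so many elements that shifting makes it avoid, from position `t` on, any
given residue class modulo `r`. These `r` members have fewer than `t` elements in common. -/
theorem IsShifted.exists_mem_nearFull {G : Finset (Finset (Fin n))} (hG : IsShifted G) (hr : 0 < r)
    (hI : WiseIntersecting r t G) {A : Finset (Fin n)} (hA : A ∈ G) :
    ∃ k, t + r * k ≤ n ∧ A ∈ nearFull (initialSegment n (t + r * k)) k := by
  by_contra! hcon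
  simp only [mem_nearFull, not_le] at hcon
  have ht : 0 < t := by
    by_contra! h0
    simpa [Nat.le_zero.1 h0, initialSegment] using hcon 0
  have havoid : ∀ c : Fin r, ∃ C ∈ G, Disjoint C (tailClass n r t c) := by
    refine fun c => hG.exists_disjoint hA fun a => ?_
    by_cases hat : t ≤ a + 1
    · have hle : t + r * ((a + 1 - t) / r) ≤ a + 1 := by
        have := Nat.mul_div_le (a + 1 - t) r
        omega
      have hsub : initialSegment n (t + r * ((a + 1 - t) / r)) ⊆ Iic a := fun x hx =>
        mem_Iic.2 (Fin.le_def.2 (by rw [mem_initialSegment] at hx; omega))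
      exact (card_Iic_inter_tailClass_le r t c a).trans
        ((hcon _ (hle.trans a.2)).trans_le (card_le_card (sdiff_subset_sdiff hsub Subset.rfl)))
    · rw [card_eq_zero.2]
      · exact Nat.zero_le _
      · refine disjoint_iff_inter_eq_empty.1 (disjoint_left.2 fun x hx hxM => ?_)
        have := Fin.le_def.1 (mem_Iic.1 hx)
        have := (mem_tailClass.1 hxM).1
        omega
  choose C hC hdisj using havoid
  have hsub : univ.inf C ⊆ initialSegment n (t - 1) := by
    intro x hx
    rw [mem_initialSegment]
    by_contra! hxt
    have hmem : x ∈ C ⟨(x + 1 - t) % r, Nat.mod_lt _ hr⟩ := inf_le (f := C) (mem_univ _) hx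
    exact disjoint_left.1 (hdisj _) hmem (mem_tailClass.2 ⟨by omega, rfl⟩)
  have hcard := (hI C hC).trans (card_le_card hsub)
  rw [card_initialSegment] at hcard
  omega

theorem franklFamily_eq_nearFull {k : ℕ} (hr : 1 ≤ r) (hn : t + r * k ≤ n) :
    franklFamily n r t k = nearFull (initialSegment n (t + r * k)) k := by
  ext A
  have hinter : ({x ∈ A | (x : ℕ) < t + r * k} : Finset (Fin n)) =
      initialSegment n (t + r * k) ∩ A := by
    ext x
    simp [initialSegment, and_comm]
  have hcard := card_sdiff_add_card_inter (initialSegment n (t + r * k)) A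
  rw [card_initialSegment, min_eq_right hn] at hcard
  have hmul : r * k = (r - 1) * k + k := by rw [← add_one_mul, Nat.sub_add_cancel hr]
  simp only [franklFamily, mem_filter, mem_univ, true_and, mem_nearFull, hinter]
  omega

theorem familyIso_nearFull {k : ℕ} (hr : 1 ≤ r) {S : Finset (Fin n)} (hS : #S = t + r * k) :
    FamilyIso (nearFull S k) (franklFamily n r t k) := by
  have hn : t + r * k ≤ n := hS ▸ card_finset_fin_le S
  have hT : #(initialSegment n (t + r * k)) = t + r * k := by
    rw [card_initialSegment, min_eq_right hn]
  let e : S ≃ initialSegment n (t + r * k) := equivOfCardEq (hS.trans hT.symm)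
  have himage : S.image e.extendSubtype = initialSegment n (t + r * k) := by
    refine eq_of_subset_of_card_le (image_subset_iff.2 fun x hx => e.extendSubtype_mem x hx) ?_
    rw [card_image_of_injective _ e.extendSubtype.injective, hS, hT]
  refine ⟨e.extendSubtype, ?_⟩
  rw [franklFamily_eq_nearFull hr hn]
  exact (congrArg (nearFull · k) himage).symm.trans (image_nearFull _ S k).symm

end InitialSegment

section Covering

variable {n r t : ℕ} {p : ℝ} {b : ℕ → ℝ} {G : Finset (Finset (Fin n))}

theorem IsShifted.exists_subset_nearFull (hG : IsShifted G) (hr : 0 < r) (hp : 0 ≤ p) (hp1 : p ≤ 1)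
    (hb : ∀ k, 0 ≤ b k) (hb_sum : Summable b) (hI : WiseIntersecting r t G)
    (hbound : ∀ k (S : Finset (Fin n)), #S = t + r * k → ¬ G ⊆ nearFull S k →
      biasedMeasure p (G ∩ nearFull S k) ≤ b k)
    (hμ : ∑' k, b k < biasedMeasure p G) :
    ∃ k, ∃ S : Finset (Fin n), #S = t + r * k ∧ G ⊆ nearFull S k := by
  by_contra! hcon
  choose k hkn hAk using fun A : G => hG.exists_mem_nearFull hr hI A.2
  refine hμ.not_ge ?_
  have hcover : G ⊆ (univ.image k).biUnion fun m =>
      G ∩ nearFull (initialSegment n (t + r * m)) m := fun A hA =>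
    mem_biUnion.2 ⟨k ⟨A, hA⟩, mem_image_of_mem k (mem_univ _), mem_inter.2 ⟨hA, hAk ⟨A, hA⟩⟩⟩
  calc biasedMeasure p G
      ≤ ∑ m ∈ univ.image k, biasedMeasure p (G ∩ nearFull (initialSegment n (t + r * m)) m) :=
        (biasedMeasure_mono hp hp1 hcover).trans (biasedMeasure_biUnion_le hp hp1 _ _)
    _ ≤ ∑ m ∈ univ.image k, b m := by
        refine sum_le_sum fun m hm => ?_
        obtain ⟨A, -, rfl⟩ := mem_image.1 hm
        have hcard : #(initialSegment n (t + r * k A)) = t + r * k A := by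
          rw [card_initialSegment, min_eq_right (hkn A)]
        exact hbound _ _ hcard (hcon _ _ hcard)
    _ ≤ ∑' m, b m := hb_sum.sum_le_tsum _ fun m _ => hb m

theorem WiseIntersecting.exists_subset_nearFull (hG : WiseIntersecting r t G) (hr : 0 < r)
    (hp : 0 ≤ p) (hp1 : p ≤ 1) (hb : ∀ k, 0 ≤ b k) (hb_sum : Summable b)
    (hbound : ∀ H : Finset (Finset (Fin n)), WiseIntersecting r t H →
      ∀ k (S : Finset (Fin n)), #S = t + r * k → ¬ H ⊆ nearFull S k →
        biasedMeasure p (H ∩ nearFull S k) ≤ b k)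
    (hμ : 2 * ∑' k, b k < biasedMeasure p G) :
    ∃ k, ∃ S : Finset (Fin n), #S = t + r * k ∧ G ⊆ nearFull S k := by
  induction G using induction_on_compression with
  | shifted G hsh =>
    have hnonneg : 0 ≤ ∑' k, b k := tsum_nonneg hb
    exact hsh.exists_subset_nearFull hr hp hp1 hb hb_sum hG (hbound G hG) (by linarith)
  | compression G i j hij ih =>
    obtain ⟨k, S, hS, hsub⟩ := ih (hG.compression hij) (by rwa [biasedMeasure_compression])
    have hS' : #(S.image (Equiv.swap i j)) = t + r * k := by
      rw [card_image_of_injective _ (Equiv.injective _), hS]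
    by_contra! hcon
    refine hμ.not_ge ?_
    calc biasedMeasure p G
        ≤ biasedMeasure p (G ∩ nearFull S k) +
            biasedMeasure p (G ∩ nearFull (S.image (Equiv.swap i j)) k) := by
          refine (biasedMeasure_mono hp hp1 ?_).trans (biasedMeasure_union_le hp hp1 _ _)
          rw [← inter_union_distrib_left]
          exact subset_inter Subset.rfl (subset_union_nearFull_of_compression_subset hsub)
      _ ≤ b k + b k :=
          add_le_add (hbound G hG k S hS (hcon k S hS)) (hbound G hG k _ hS' (hcon k _ hS'))
      _ ≤ 2 * ∑' k, b k := by linarith [hb_sum.le_tsum k fun m _ => hb m]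

end Covering

section Threshold

open Filter

variable {s : ℕ} {p η δ : ℝ}

theorem card_mul_pow_le {X : Type*} {S : Finset X} {t k : ℕ} (hs : s ≠ 0) (hp : 0 ≤ p)
    (hp1 : p ≤ 1) (hpη : p ≤ η) (htp : t * p ^ s ≤ 1 + η) (hS : #S = t + (s + 1) * k) :
    #S * p ^ s ≤ 1 + η * ((s + 1) * k + 1) := by
  have hpow : p ^ s ≤ η := (pow_le_of_le_one hp hp1 hs).trans hpη
  calc #S * p ^ s = t * p ^ s + (s + 1) * k * p ^ s := by
        rw [hS]
        push_cast
        ring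
    _ ≤ 1 + η + (s + 1) * k * η := by gcongr
    _ = 1 + η * ((s + 1) * k + 1) := by ring

theorem one_add_mul_le_of_le_quarter (hη : 0 ≤ η) (hsη : (s + 1) * η ≤ 1 / 4) (k : ℕ) :
    1 + η * ((s + 1) * k + 1) ≤ (k + 5) / 4 := by
  have h₁ : (s + 1) * η * k ≤ 1 / 4 * k := by gcongr
  have h₂ : 0 ≤ s * η := by positivity
  linarith

theorem pow_div_factorial_le_exp_mul_pow {x : ℝ} {k : ℕ} (hx : 0 ≤ x) (hxk : x ≤ (k + 5) / 4) :
    x ^ k / k.factorial ≤ Real.exp 5 * (Real.exp 1 / 4) ^ k := by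
  calc x ^ k / k.factorial ≤ ((k + 5) / 4) ^ k / k.factorial := by gcongr
    _ = ((k : ℝ) + 5) ^ k / k.factorial / 4 ^ k := by
        rw [div_pow]
        ring
    _ ≤ Real.exp (k + 5) / 4 ^ k := by
        gcongr
        exact Real.pow_div_factorial_le_exp _ (by positivity) k
    _ = Real.exp 5 * (Real.exp 1 / 4) ^ k := by
        rw [add_comm, Real.exp_add, div_pow, Real.exp_one_pow, mul_div_assoc]

theorem summable_exp_mul_pow : Summable fun k : ℕ => Real.exp 5 * (Real.exp 1 / 4) ^ k :=
  (summable_geometric_of_lt_one (by positivity)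
    ((div_lt_one (by norm_num)).2 (by linarith [Real.exp_one_lt_d9]))).mul_left _

/-- A bound for the part inside `nearFull S k`, where `|S| = t + (s + 1) k`, of an `(s + 1)`-wise
`t`-intersecting family that is not contained in it, relative to `p ^ t`. The first term tends to
zero with `η ≥ p`; the second one bounds all of `nearFull S k` and makes the bound summable in `k`,
uniformly in `η`. -/
noncomputable def exclusionBound (s k : ℕ) (η : ℝ) : ℝ :=
  min ((4 * s * (2 * (k + 2)) ^ k + (k + 1) * (k + 2) ^ k) * η)
    (Real.exp 5 * (Real.exp 1 / 4) ^ k)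

theorem exclusionBound_nonneg (hη : 0 ≤ η) (s k : ℕ) : 0 ≤ exclusionBound s k η :=
  le_min (by positivity) (by positivity)

theorem summable_exclusionBound (hη : 0 ≤ η) (s : ℕ) : Summable fun k => exclusionBound s k η :=
  summable_exp_mul_pow.of_nonneg_of_le (exclusionBound_nonneg hη s) fun _ => min_le_right _ _

theorem tendsto_tsum_exclusionBound (s : ℕ) :
    Tendsto (fun η => ∑' k, exclusionBound s k η) (𝓝[>] 0) (𝓝 0) := by
  have hterm : ∀ k, Tendsto (exclusionBound s k) (𝓝[>] 0) (𝓝 0) := fun k => by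
    have hcont : Continuous (exclusionBound s k) := by
      unfold exclusionBound
      fun_prop
    have hzero : exclusionBound s k 0 = 0 := by
      rw [exclusionBound, mul_zero]
      exact min_eq_left (by positivity)
    exact (hzero ▸ hcont.tendsto 0).mono_left nhdsWithin_le_nhds
  have hdom : ∀ᶠ η in 𝓝[>] (0 : ℝ), ∀ k,
      ‖exclusionBound s k η‖ ≤ Real.exp 5 * (Real.exp 1 / 4) ^ k := by
    filter_upwards [self_mem_nhdsWithin] with η hη k
    rw [Real.norm_of_nonneg (exclusionBound_nonneg (le_of_lt hη) s k)]
    exact min_le_right _ _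
  simpa only [tsum_zero] using
    tendsto_tsum_of_dominated_convergence summable_exp_mul_pow hterm hdom

theorem WiseIntersecting.biasedMeasure_inter_nearFull_le_exclusionBound {X : Type*} [Fintype X]
    [DecidableEq X] {t k : ℕ} {G : Finset (Finset X)} {S : Finset X}
    (hG : WiseIntersecting (s + 1) t G) (hs : 2 ≤ s) (hp : 0 < p) (hp1 : p ≤ 1) (hpη : p ≤ η)
    (hsη : (s + 1) * η ≤ 1 / 4) (htp : t * p ^ s ≤ 1 + η) (hS : #S = t + (s + 1) * k)
    (hGS : ¬ G ⊆ nearFull S k) :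
    biasedMeasure p (G ∩ nearFull S k) ≤ exclusionBound s k η * p ^ t := by
  have hcard : #S * p ^ s ≤ (k + 5) / 4 :=
    (card_mul_pow_le (by omega) hp.le hp1 hpη htp hS).trans
      (one_add_mul_le_of_le_quarter (hp.le.trans hpη) hsη k)
  have hk : (0 : ℝ) ≤ k := k.cast_nonneg
  rw [exclusionBound, min_mul_of_nonneg _ _ (by positivity)]
  refine le_min ?_ ?_
  · refine (hG.biasedMeasure_inter_nearFull_le (M := k + 2) hs hp hp1 (by linarith) hS
      (by linarith) hGS).trans ?_
    gcongr
  · refine (biasedMeasure_mono hp.le hp1 inter_subset_right).trans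
      ((biasedMeasure_nearFull_le_pow_div_factorial hp.le hp1 hS).trans ?_)
    gcongr
    exact pow_div_factorial_le_exp_mul_pow (by positivity) hcard

theorem eventually_add_one_mul_le_quarter (s : ℕ) :
    ∀ᶠ η in 𝓝[>] (0 : ℝ), ((s : ℝ) + 1) * η ≤ 1 / 4 := by
  have hcont : Continuous fun η : ℝ => ((s : ℝ) + 1) * η := by fun_prop
  exact nhdsWithin_le_nhds ((hcont.tendsto 0).eventually_le_const (by norm_num))

theorem eventually_forall_pow_div_factorial_lt (s : ℕ) (hδ : 0 < δ) :
    ∀ᶠ η in 𝓝[>] (0 : ℝ), ∀ k : ℕ, 2 ≤ k →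
      (1 + η * ((s + 1) * k + 1)) ^ k / k.factorial < 1 / 2 + δ := by
  have hpos : 0 < 1 / 2 + δ := by positivity
  obtain ⟨K, hK⟩ := eventually_atTop.1
    (summable_exp_mul_pow.tendsto_atTop_zero.eventually_lt_const hpos)
  have hsmall : ∀ᶠ η in 𝓝[>] (0 : ℝ), ∀ k ∈ Finset.Ico 2 K,
      (1 + η * ((s + 1) * k + 1)) ^ k / k.factorial < 1 / 2 + δ := by
    rw [eventually_all_finset]
    intro k hk
    have hcont : Continuous fun η : ℝ => (1 + η * ((s + 1) * k + 1)) ^ k / k.factorial := by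
      fun_prop
    refine nhdsWithin_le_nhds ((hcont.tendsto 0).eventually_lt_const ?_)
    have hfact : (2 : ℝ) ≤ k.factorial := mod_cast Nat.factorial_le (Finset.mem_Ico.1 hk).1
    have : (1 : ℝ) / k.factorial ≤ 1 / 2 := by gcongr
    simp only [zero_mul, add_zero, one_pow]
    linarith
  filter_upwards [self_mem_nhdsWithin, hsmall, eventually_add_one_mul_le_quarter s]
    with η (hη : 0 < η) hsmall hquarter k hk
  rcases lt_or_ge k K with hkK | hkK
  · exact hsmall k (Finset.mem_Ico.2 ⟨hk, hkK⟩)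
  · exact (pow_div_factorial_le_exp_mul_pow (by positivity)
      (one_add_mul_le_of_le_quarter hη.le hquarter k)).trans_lt (hK k hkK)

theorem biasedMeasure_nearFull_lt {X : Type*} [Fintype X] [DecidableEq X] {t k : ℕ}
    {S : Finset X} (hs : s ≠ 0) (hp : 0 < p) (hp1 : p ≤ 1) (hpη : p ≤ η)
    (htp : t * p ^ s ≤ 1 + η) (hS : #S = t + (s + 1) * k)
    (hlt : (1 + η * ((s + 1) * k + 1)) ^ k / k.factorial < 1 / 2 + δ) :
    biasedMeasure p (nearFull S k) < (1 / 2 + δ) * p ^ t := by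
  have hcard := card_mul_pow_le hs hp.le hp1 hpη htp hS
  calc biasedMeasure p (nearFull S k) ≤ (#S * p ^ s) ^ k / k.factorial * p ^ t :=
        biasedMeasure_nearFull_le_pow_div_factorial hp.le hp1 hS
    _ ≤ (1 + η * ((s + 1) * k + 1)) ^ k / k.factorial * p ^ t := by gcongr
    _ < (1 / 2 + δ) * p ^ t := by gcongr

theorem WiseIntersecting.exists_subset_nearFull_of_tsum_lt {n t : ℕ}
    {G : Finset (Finset (Fin n))} (hG : WiseIntersecting (s + 1) t G) (hs : 2 ≤ s) (hp : 0 < p)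
    (hp1 : p ≤ 1) (hpη : p ≤ η) (hsη : (s + 1) * η ≤ 1 / 4) (htp : t * p ^ s ≤ 1 + η)
    (hμ : (2 * ∑' k, exclusionBound s k η) * p ^ t < biasedMeasure p G) :
    ∃ k, ∃ S : Finset (Fin n), #S = t + (s + 1) * k ∧ G ⊆ nearFull S k := by
  have hη : 0 ≤ η := hp.le.trans hpη
  refine hG.exists_subset_nearFull (b := fun k => exclusionBound s k η * p ^ t) s.succ_pos hp.le hp1
    (fun k => mul_nonneg (exclusionBound_nonneg hη s k) (by positivity))
    ((summable_exclusionBound hη s).mul_right _) (fun H hH k S hS hHS => ?_) ?_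
  · exact hH.biasedMeasure_inter_nearFull_le_exclusionBound hs hp hp1 hpη hsη htp hS hHS
  · rwa [tsum_mul_right, ← mul_assoc]

/-- `pZero t` is the positive root of `(t + 2) p² = 1 + p`, the equation that equates the
measures of the Frankl families with `i = 0` and `i = 1`. -/
theorem add_two_mul_sq_le_of_le_pZero {t : ℕ} (hp : 0 < p) (h : p ≤ pZero t) :
    (t + 2) * p ^ 2 ≤ 1 + p := by
  have hsq := Real.sq_sqrt (by positivity : (0 : ℝ) ≤ 4 * t + 9)
  have hsqrt : 1 < √(4 * t + 9) :=
    Real.lt_sqrt_of_sq_lt (by linarith [(Nat.cast_nonneg t : (0 : ℝ) ≤ t)])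
  rw [pZero, le_div_iff₀ (by linarith)] at h
  have hle : (p * √(4 * t + 9)) ^ 2 ≤ (2 + p) ^ 2 :=
    pow_le_pow_left₀ (by positivity) (by linarith) 2
  rw [mul_pow, hsq] at hle
  linarith

theorem exists_forall_le_of_le_pZero (hη : 0 < η) :
    ∃ t₀ : ℕ, ∀ (t : ℕ) (p : ℝ), t₀ < t → 0 < p → p ≤ pZero t → p ≤ η ∧ t * p ^ 2 ≤ 1 + η := by
  obtain ⟨t₀, ht₀⟩ := exists_nat_gt (2 / η ^ 2)
  refine ⟨t₀, fun t p ht hp hpt => ?_⟩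
  have hroot := add_two_mul_sq_le_of_le_pZero hp hpt
  have hle : p ≤ η := by
    by_contra! hlt
    have h₁ : 2 < t₀ * η ^ 2 := (div_lt_iff₀ (by positivity)).1 ht₀
    have h₂ : t₀ * η ^ 2 ≤ t * p ^ 2 := by gcongr
    nlinarith [sq_nonneg (p - 1)]
  exact ⟨hle, by nlinarith [sq_nonneg p]⟩

end Threshold

theorem theorem5_general {r : ℕ} (hr : 3 ≤ r) {δ : ℝ} (hδ : 0 < δ) :
    ∃ η > 0, ∀ (t : ℕ) (p : ℝ), 0 < p → p ≤ η → t * p ^ (r - 1) ≤ 1 + η →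
      ∀ (n : ℕ) (G : Finset (Finset (Fin n))),
        WiseIntersecting r t G →
        (1 / 2 + δ) * p ^ t ≤ biasedMeasure p G →
        ∃ F : Finset (Finset (Fin n)), G ⊆ F ∧
          ((t ≤ n ∧ FamilyIso F (franklFamily n r t 0)) ∨
            (t + r ≤ n ∧ FamilyIso F (franklFamily n r t 1))) := by
  obtain ⟨s, rfl⟩ := Nat.exists_eq_add_of_le' (by omega : 1 ≤ r)
  simp only [Nat.add_sub_cancel]
  obtain ⟨η, hη, hsη, hsum, hfact⟩ := (eventually_mem_nhdsWithin.and
    ((eventually_add_one_mul_le_quarter s).and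
      (((tendsto_tsum_exclusionBound s).eventually_lt_const (by norm_num : (0 : ℝ) < 1 / 4)).and
        (eventually_forall_pow_div_factorial_lt s hδ)))).exists
  refine ⟨η, hη, fun t p hp hpη htp n G hG hμ => ?_⟩
  have hp1 : p ≤ 1 := by nlinarith [(s.cast_nonneg : (0 : ℝ) ≤ s)]
  have htsum : (2 * ∑' k, exclusionBound s k η) * p ^ t < biasedMeasure p G :=
    lt_of_lt_of_le (by gcongr; linarith) hμ
  obtain ⟨k, S, hS, hGS⟩ :=
    hG.exists_subset_nearFull_of_tsum_lt (by omega) hp hp1 hpη hsη htp htsum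
  have hk : k < 2 := by
    by_contra! hk
    exact (hμ.trans (biasedMeasure_mono hp.le hp1 hGS)).not_gt
      (biasedMeasure_nearFull_lt (by omega) hp hp1 hpη htp hS (hfact k hk))
  have hSn := card_finset_fin_le S
  have hiso := familyIso_nearFull (by omega) hS
  refine ⟨nearFull S k, hGS, ?_⟩
  interval_cases k
  · exact Or.inl ⟨by omega, hiso⟩
  · exact Or.inr ⟨by omega, hiso⟩

theorem theorem5 :
    ∀ δ : ℝ, 0 < δ → ∃ t₀ : ℕ, ∀ (t : ℕ) (p : ℝ), t₀ < t → 0 < p → p ≤ pZero t →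
      ∀ (n : ℕ) (G : Finset (Finset (Fin n))),
        WiseIntersecting 3 t G →
        (1 / 2 + δ) * p ^ t ≤ biasedMeasure p G →
        ∃ F : Finset (Finset (Fin n)), G ⊆ F ∧
          ((t ≤ n ∧ FamilyIso F (franklFamily n 3 t 0)) ∨
            (t + 3 ≤ n ∧ FamilyIso F (franklFamily n 3 t 1))) := by
  intro δ hδ
  obtain ⟨η, hη, h⟩ := theorem5_general le_rfl hδ
  obtain ⟨t₀, ht₀⟩ := exists_forall_le_of_le_pZero hη
  exact ⟨t₀, fun t p ht hp hpt => h t p hp (ht₀ t p ht hp hpt).1 (ht₀ t p ht hp hpt).2⟩
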